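/- Let $\mathbb{W}=W(\mathbb{F}_4)$ be the ring of $2$-typical Witt vectors of $\mathbb{F}_4$, let $a\mapsto\bar a$ be the lift of the Frobenius of $\mathbb{F}_4$ to $\mathbb{W}$, and let $$\mathcal{O}_2=\mathbb{W}\langle S\rangle/(S^2=2,\ Sa=\bar a S)$$ be the maximal order of the quaternion division algebra over $\mathbb{Q}_2$, with its $2$-adic topology. Every element of $\mathcal{O}_2$ is uniquely of the form $a+bS$ with $a,b\in\mathbb{W}$, and its reduced norm is $N(a+bS)=a\bar a-2b\bar b$. Let $\mathbb{S}_2=\mathcal{O}_2^\times$ be the second Morava stabilizer group at the prime $2$, let $\mathbb{S}_2^0\subseteq\mathbb{S}_2$ be the subgroup of the elements $a+bS$ with $a\equiv 1\pmod 2$ (the $2$-Sylow subgroup), and let $$\mathbb{S}l_2^0=\{x\in\mathbb{S}_2^0 : N(x)=1\},$$ a pro-$2$ group. Define functions $t_i:\mathbb{S}_2^0\to\mathbb{F}_4$, $i\ge 1$, by the unique expansion $$x=(1+2[t_2(x)]+2^2[t_4(x)]+\cdots)+([t_1(x)]+2[t_3(x)]+2^2[t_5(x)]+\cdots)S,$$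 where $[\,\cdot\,]:\mathbb{F}_4\to\mathbb{W}$ is the Teichmüller lift. Then a subgroup $H$ of $\mathbb{S}l_2^0$ is dense in $\mathbb{S}l_2^0$ if and only if the map $$H\longrightarrow\mathbb{F}_4\oplus\mathbb{F}_4,\qquad x\longmapsto\bigl(t_1(x),\ t_3(x)+t_1(x)t_2(x)\bigr)$$ is surjective. -/

import Mathlib

namespace MoravaStabilizer

noncomputable section

/-- The field `𝔽_{p²}`. -/
abbrev Fq (p : ℕ) [Fact p.Prime] : Type := GaloisField p 2

/-- The ring `𝕎 = 𝕎(𝔽_{p²})` of `p`-typical Witt vectors over `𝔽_{p²}`. -/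
abbrev W (p : ℕ) [Fact p.Prime] : Type := WittVector p (Fq p)

/-- The conjugation `a ↦ ā` of `𝕎`, the lift of the Frobenius of `𝔽_{p²}`. -/
def bar (p : ℕ) [Fact p.Prime] : W p →+* W p := WittVector.frobenius

theorem bar_bar (p : ℕ) [Fact p.Prime] (a : W p) : bar p (bar p a) = a := by
  ext n
  have : Fintype (Fq p) := Fintype.ofFinite _
  have hc : Fintype.card (Fq p) = p ^ 2 := by
    rw [← Nat.card_eq_fintype_card]; exact GaloisField.card p 2 two_ne_zero
  simp only [bar, WittVector.coeff_frobenius_charP]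
  rw [← pow_mul, ← sq, ← hc, FiniteField.pow_card]

/-- The maximal order `𝒪_p = 𝕎⟨S⟩ / (S² = p, S a = ā S)`. Its elements are written uniquely as
`a + b S` with `a, b ∈ 𝕎`; here `a = re` and `b = im`. -/
@[ext]
structure Op (p : ℕ) [Fact p.Prime] : Type where
  re : W p
  im : W p

namespace Op

variable {p : ℕ} [Fact p.Prime]

instance : Zero (Op p) := ⟨⟨0, 0⟩⟩
instance : One (Op p) := ⟨⟨1, 0⟩⟩
instance : Add (Op p) := ⟨fun x y => ⟨x.re + y.re, x.im + y.im⟩⟩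
instance : Neg (Op p) := ⟨fun x => ⟨-x.re, -x.im⟩⟩
/-- `(a + b S)(c + d S) = (a c + p b d̄) + (a d + b c̄) S`. -/
instance : Mul (Op p) :=
  ⟨fun x y => ⟨x.re * y.re + p * (x.im * bar p y.im), x.re * y.im + x.im * bar p y.re⟩⟩

@[simp] theorem zero_re : (0 : Op p).re = 0 := rfl
@[simp] theorem zero_im : (0 : Op p).im = 0 := rfl
@[simp] theorem one_re : (1 : Op p).re = 1 := rfl
@[simp] theorem one_im : (1 : Op p).im = 0 := rfl
@[simp] theorem add_re (x y : Op p) : (x + y).re = x.re + y.re := rfl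
@[simp] theorem add_im (x y : Op p) : (x + y).im = x.im + y.im := rfl
@[simp] theorem neg_re (x : Op p) : (-x).re = -x.re := rfl
@[simp] theorem neg_im (x : Op p) : (-x).im = -x.im := rfl
@[simp] theorem mul_re (x y : Op p) :
    (x * y).re = x.re * y.re + p * (x.im * bar p y.im) := rfl
@[simp] theorem mul_im (x y : Op p) :
    (x * y).im = x.re * y.im + x.im * bar p y.re := rfl

instance : Ring (Op p) where
  add_assoc x y z := by ext1 <;> simp [add_assoc]
  zero_add x := by ext1 <;> simp
  add_zero x := by ext1 <;> simp
  add_comm x y := by ext1 <;> simp [add_comm]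
  neg_add_cancel x := by ext1 <;> simp
  mul_assoc x y z := by
    ext1
    · simp only [mul_re, mul_im, map_add, map_mul, bar_bar]; ring
    · simp only [mul_re, mul_im, map_add, map_mul, map_natCast, bar_bar]; ring
  one_mul x := by ext1 <;> simp
  mul_one x := by ext1 <;> simp
  zero_mul x := by ext1 <;> simp
  mul_zero x := by ext1 <;> simp
  left_distrib x y z := by
    ext1
    · simp only [mul_re, add_re, add_im, map_add]; ring
    · simp only [mul_im, add_re, add_im, map_add]; ring
  right_distrib x y z := by
    ext1
    · simp only [mul_re, add_re, add_im]; ring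
    · simp only [mul_im, add_re, add_im]; ring
  nsmul := nsmulRec
  zsmul := zsmulRec

/-- The `p`-adic topology of `𝒪_p ≅ 𝕎 × 𝕎`: the product of the `p`-adic topologies of `𝕎`. -/
instance : TopologicalSpace (Op p) :=
  TopologicalSpace.induced re (Ideal.span {(p : W p)}).adicTopology ⊓
    TopologicalSpace.induced im (Ideal.span {(p : W p)}).adicTopology

/-- The reduced norm `N(a + b S) = a ā - p b b̄`. Its values are fixed by the conjugation of `𝕎`
(see `bar_norm`), that is, they lie in `ℤ_p ⊆ 𝕎`. -/
def norm : Op p →* W p where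
  toFun x := x.re * bar p x.re - p * (x.im * bar p x.im)
  map_one' := by simp
  map_mul' x y := by
    simp only [mul_re, mul_im, map_add, map_mul, map_natCast, bar_bar]; ring

theorem bar_norm (x : Op p) : bar p (norm x) = norm x := by
  change bar p (x.re * bar p x.re - p * (x.im * bar p x.im)) =
    x.re * bar p x.re - p * (x.im * bar p x.im)
  simp only [map_sub, map_mul, map_natCast, bar_bar]; ring

/-- The reduction `𝒪_p → 𝒪_p / (S) = 𝔽_{p²}`, `a + b S ↦ a mod p`. -/
def residue : Op p →+* Fq p where
  toFun x := WittVector.constantCoeff x.re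
  map_one' := by simp
  map_zero' := by simp
  map_add' x y := map_add WittVector.constantCoeff x.re y.re
  map_mul' x y := by
    have h : WittVector.constantCoeff (p : W p) = 0 := by
      rw [map_natCast, CharP.cast_eq_zero]
    rw [mul_re, map_add, map_mul, map_mul, h, zero_mul, add_zero]

end Op

/-- The Morava stabilizer group `𝕊₂ = 𝒪_p^×`, with the topology of a group of units. -/
abbrev S2 (p : ℕ) [Fact p.Prime] : Type := (Op p)ˣ

/-- The `p`-Sylow subgroup `𝕊₂⁰` of `𝕊₂`, the kernel of `𝕊₂ → 𝔽_{p²}^×`. -/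
def S20 (p : ℕ) [Fact p.Prime] : Subgroup (S2 p) :=
  (Units.map (Op.residue : Op p →+* Fq p).toMonoidHom).ker

/-- `𝕊₂⁰` consists of the units `a + b S` with `a ≡ 1 (mod p)`. -/
theorem mem_S20_iff (p : ℕ) [Fact p.Prime] (x : S2 p) :
    x ∈ S20 p ↔ (p : W p) ∣ (x : Op p).re - 1 := by
  rw [← Ideal.mem_span_singleton, ← WittVector.ker_constantCoeff, RingHom.mem_ker, map_sub,
    map_one, sub_eq_zero, S20, MonoidHom.mem_ker, Units.ext_iff]
  rfl

/-- The subgroup `𝕊l₂⁰` of `𝕊₂⁰` of the elements of reduced norm `1`, with the subspace topology. -/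
def Sl20 (p : ℕ) [Fact p.Prime] : Subgroup (S20 p) :=
  ((Units.map (Op.norm : Op p →* W p)).comp (S20 p).subtype).ker

/-- The element `s_i ∈ 𝔽_{p²}` in the unique expansion `w = ∑ i, [s_i] p ^ i` of `w ∈ 𝕎` through
Teichmüller lifts (the `i`-th Witt coordinate of `w` is `s_i ^ (p ^ i)`). -/
def digit (p : ℕ) [Fact p.Prime] (w : W p) (i : ℕ) : Fq p :=
  ((frobeniusEquiv (Fq p) p).symm ^ i) (w.coeff i)

theorem digit_spec (p : ℕ) [Fact p.Prime] (w : W p) (n : ℕ) :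
    (p : W p) ^ (n + 1) ∣
      w - ∑ i ∈ Finset.Iic n, WittVector.teichmuller p (digit p w i) * (p : W p) ^ i :=
  WittVector.dvd_sub_sum_teichmuller_iterateFrobeniusEquiv_coeff w n

/-- The functions `t_n : 𝕊₂⁰ → 𝔽_{p²}` with
`x = (1 + p [t₂] + p² [t₄] + ⋯) + ([t₁] + p [t₃] + p² [t₅] + ⋯) S`. -/
def t {p : ℕ} [Fact p.Prime] (n : ℕ) (x : S20 p) : Fq p :=
  if Even n then digit p ((x : S2 p) : Op p).re (n / 2)
  else digit p ((x : S2 p) : Op p).im (n / 2)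

end

end MoravaStabilizer

namespace MoravaStabilizer

open WittVector

/-! Filter by powers of `S`. The norm condition gives t₂ + t₂² = t₁³ (`t_two_add_sq`), which makes
`q` = t₃ + t₁t₂ additive on `Sl20`; it also forces leading coefficients at even levels into 𝔽₂
(`residue_eq_zero_or_one`).

If `H` is dense, it meets every class modulo 4. The pair (t₁, `q`) depends only on that class and
takes all values on `Sl20` (`exists_t_one_eq_and_q_eq`).

Conversely, surjectivity supplies all leading coefficients at levels 1 and 3. Squaring raises a
level n ≥ 3 by 2 and keeps the coefficient, because S² = 2. Level 2 comes from squaring level 1, and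
level 4 from commutators of levels 1 and 3. So `H` attains every coefficient possible in `Sl20`, and
successive approximation (`exists_mem_mul_eq`) gives density. -/

/-- The reduction `𝕎 → 𝔽₄` modulo `2`. -/
noncomputable def reduction : W 2 →+* Fq 2 := WittVector.constantCoeff

local notation "τ" => WittVector.teichmuller (R := Fq 2) 2
local notation "ρ" => reduction

/-! ### Arithmetic of 𝔽₄ and of 𝕎 modulo 4 -/

theorem Fq_pow_four (a : Fq 2) : a ^ 4 = a := by
  have : Fintype (Fq 2) := Fintype.ofFinite _
  have hc : Fintype.card (Fq 2) = 4 := by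
    rw [← Nat.card_eq_fintype_card, GaloisField.card 2 2 two_ne_zero]; norm_num
  rw [← hc, FiniteField.pow_card]

theorem Fq_add_self (a : Fq 2) : a + a = 0 := CharTwo.add_self_eq_zero a

theorem Fq_pow_three {a : Fq 2} (ha : a ≠ 0) : a ^ 3 = 1 :=
  mul_left_cancel₀ ha (by linear_combination Fq_pow_four a)

theorem Fq_eq_zero_or_one {a : Fq 2} (h : a + a ^ 2 = 0) : a = 0 ∨ a = 1 := by
  have h' : a * (a - 1) = 0 := by linear_combination h - Fq_add_self a
  rcases mul_eq_zero.mp h' with h | h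
  · exact .inl h
  · exact .inr (sub_eq_zero.mp h)

/-- A primitive cube root of unity in `𝔽₄`. -/
theorem exists_omega : ∃ w : Fq 2, w ^ 2 + w = 1 := by
  have hc : Nat.card (Fq 2) = 4 := by
    rw [GaloisField.card 2 2 two_ne_zero]; norm_num
  have : Fintype (Fq 2) := Fintype.ofFinite _
  classical
  obtain ⟨w, -, hw⟩ : ∃ w ∈ (Finset.univ : Finset (Fq 2)), w ∉ ({0, 1} : Finset (Fq 2)) := by
    apply Finset.exists_mem_notMem_of_card_lt_card
    rw [Finset.card_univ, ← Nat.card_eq_fintype_card, hc]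
    exact Finset.card_le_two.trans_lt (by norm_num)
  simp only [Finset.mem_insert, Finset.mem_singleton, not_or] at hw
  refine ⟨w, mul_left_cancel₀ (sub_ne_zero.mpr hw.2) ?_⟩
  linear_combination Fq_pow_three hw.1 - Fq_add_self w + Fq_add_self 1

@[simp] theorem residue_two : ρ 2 = 0 := by
  rw [map_ofNat]; exact CharTwo.two_eq_zero

theorem two_ne_zero_W : (2 : W 2) ≠ 0 := by
  simpa using WittVector.p_nonzero 2 (Fq 2)

theorem exists_two_mul {w : W 2} (h : ρ w = 0) : ∃ v, w = 2 * v := by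
  have : w ∈ RingHom.ker (WittVector.constantCoeff : W 2 →+* Fq 2) := h
  rw [WittVector.ker_constantCoeff, Ideal.mem_span_singleton] at this
  simpa [dvd_def] using this

@[simp] theorem residue_bar (w : W 2) : ρ (bar 2 w) = ρ w ^ 2 := by
  change (WittVector.frobenius w).coeff 0 = _
  rw [WittVector.coeff_frobenius_charP]; rfl

@[simp] theorem residue_teichmuller (a : Fq 2) : ρ (τ a) = a :=
  WittVector.teichmuller_coeff_zero 2 a

@[simp] theorem bar_teichmuller (a : Fq 2) : bar 2 (τ a) = τ (a ^ 2) := by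
  change WittVector.frobenius (τ a) = _
  rw [WittVector.frobenius_eq_map_frobenius, WittVector.map_teichmuller, frobenius_def]

/-- Squaring a congruence modulo 2 determines the squares modulo 4, and in 𝔽₄ the square root of a
is a². The carry is thus the square root of ab. -/
theorem exists_teichmuller_add (a b : Fq 2) :
    ∃ v, τ a + τ b = τ (a + b) + 2 * v ∧ ρ v = a ^ 2 * b ^ 2 := by
  obtain ⟨u, hu⟩ := exists_two_mul (w := τ (a ^ 2 + b ^ 2) - (τ (a ^ 2) + τ (b ^ 2))) (by simp)
  have h (c : Fq 2) : τ (c ^ 2) ^ 2 = τ c := by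
    rw [← map_pow, ← pow_mul, Fq_pow_four]
  have h' : τ (a ^ 2 + b ^ 2) ^ 2 = τ (a + b) := by
    rw [← add_pow_char, h]
  refine ⟨-(2 * u * (τ (a ^ 2) + τ (b ^ 2)) + 2 * u ^ 2 + τ (a ^ 2) * τ (b ^ 2)), ?_, ?_⟩
  · linear_combination h' - h a - h b -
      (τ (a ^ 2 + b ^ 2) + (τ (a ^ 2) + τ (b ^ 2)) + 2 * u) * hu
  · simp [CharTwo.neg_eq]

theorem digit_eq (w : W 2) :
    digit 2 w 0 = ρ w ∧ ∃ v, w = τ (ρ w) + 2 * v ∧ ρ v = digit 2 w 1 := by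
  have h0 : digit 2 w 0 = ρ w := by simp [digit, reduction]
  obtain ⟨z, hz⟩ := digit_spec 2 w 1
  have : (Finset.Iic 1 : Finset ℕ) = {0, 1} := rfl
  rw [this, Finset.sum_pair zero_ne_one, h0] at hz
  push_cast at hz
  refine ⟨h0, τ (digit 2 w 1) + 2 * z, by linear_combination hz, by simp⟩

theorem digit_one_eq {w v : W 2} {a : Fq 2} (h : w = τ a + 2 * v) : digit 2 w 1 = ρ v := by
  obtain ⟨v', hv, hv'⟩ := (digit_eq w).2
  have ha : ρ w = a := by rw [h]; simp
  have : v = v' := mul_left_cancel₀ two_ne_zero_W (by rw [ha] at hv; linear_combination hv - h)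
  rw [this, hv']

theorem digit_zero_eq (w : W 2) : digit 2 w 0 = ρ w := (digit_eq w).1

theorem digit_eq_of_four_dvd {w w' : W 2} (h : (4 : W 2) ∣ w - w') :
    digit 2 w 0 = digit 2 w' 0 ∧ digit 2 w 1 = digit 2 w' 1 := by
  obtain ⟨z, hz⟩ := h
  obtain ⟨v, hv, hv'⟩ := (digit_eq w').2
  refine ⟨?_, ?_⟩
  · rw [digit_zero_eq, digit_zero_eq, sub_eq_iff_eq_add.mp hz, map_add, map_mul,
      show (4 : W 2) = 2 * 2 by norm_num, map_mul]
    simp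
  · rw [← hv', digit_one_eq (v := v + 2 * z) (a := ρ w') (by linear_combination hz + hv)]
    simp

/-! ### The functions `t₁`, `t₂`, `t₃` -/

/-- The map `x ↦ t₃(x) + t₁(x) t₂(x)`. -/
noncomputable def q (x : S20 2) : Fq 2 := t 3 x + t 1 x * t 2 x

theorem t_one (x : S20 2) : t 1 x = digit 2 ((x : S2 2) : Op 2).im 0 := by
  simp [t]

theorem t_two (x : S20 2) : t 2 x = digit 2 ((x : S2 2) : Op 2).re 1 := by
  simp [t]

theorem t_three (x : S20 2) : t 3 x = digit 2 ((x : S2 2) : Op 2).im 1 := by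
  simp [t, show ¬ Even 3 by decide]

theorem t_of_eq {x : S20 2} {a : Fq 2} {u v : W 2} (hre : ((x : S2 2) : Op 2).re = 1 + 2 * u)
    (him : ((x : S2 2) : Op 2).im = τ a + 2 * v) :
    t 1 x = a ∧ t 2 x = ρ u ∧ t 3 x = ρ v := by
  refine ⟨?_, ?_, ?_⟩
  · rw [t_one, digit_zero_eq, him]; simp
  · rw [t_two, digit_one_eq (a := 1)]; rw [hre, map_one]
  · rw [t_three, digit_one_eq him]

theorem exists_eq (x : S20 2) : ∃ u v : W 2, ((x : S2 2) : Op 2).re = 1 + 2 * u ∧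
    ((x : S2 2) : Op 2).im = τ (t 1 x) + 2 * v ∧ t 2 x = ρ u ∧ t 3 x = ρ v := by
  obtain ⟨u, hu⟩ := (mem_S20_iff 2 x).mp x.2
  obtain ⟨v, hv, -⟩ := (digit_eq ((x : S2 2) : Op 2).im).2
  push_cast at hu
  have hu' : ((x : S2 2) : Op 2).re = 1 + 2 * u := by linear_combination hu
  have h1 : t 1 x = ρ ((x : S2 2) : Op 2).im := by rw [t_one, digit_zero_eq]
  rw [← h1] at hv
  exact ⟨u, v, hu', hv, (t_of_eq hu' hv).2⟩

theorem norm_eq_one {x : S20 2} (hx : x ∈ Sl20 2) : Op.norm ((x : S2 2) : Op 2) = 1 :=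
  congrArg Units.val (MonoidHom.mem_ker.mp hx)

theorem norm_eq_one' {x : S20 2} (hx : x ∈ Sl20 2) :
    ((x : S2 2) : Op 2).re * bar 2 ((x : S2 2) : Op 2).re
      - 2 * (((x : S2 2) : Op 2).im * bar 2 ((x : S2 2) : Op 2).im) = 1 := by
  exact norm_eq_one hx

theorem t_two_add_sq {x : S20 2} (hx : x ∈ Sl20 2) : t 2 x + t 2 x ^ 2 = t 1 x ^ 3 := by
  obtain ⟨u, v, hre, him, h2, -⟩ := exists_eq x
  have h := norm_eq_one' hx
  have h' : u + bar 2 u + 2 * (u * bar 2 u) =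
      ((x : S2 2) : Op 2).im * bar 2 ((x : S2 2) : Op 2).im := by
    refine mul_left_cancel₀ two_ne_zero_W ?_
    rw [hre] at h
    simp only [map_add, map_mul, map_one, map_ofNat] at h
    linear_combination h
  have h'' := congrArg ρ h'
  rw [him] at h''
  simp only [map_add, map_mul, residue_two, residue_bar, zero_mul, add_zero, residue_teichmuller] at h''
  rw [h2, h'']; ring

/-- The last term of t₃ is the carry from adding the Teichmüller lifts of the two t₁; the squares on
the right factor come from Sa = āS. -/
theorem t_mul (x y : S20 2) : t 1 (x * y) = t 1 x + t 1 y ∧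
    t 2 (x * y) = t 2 x + t 2 y + t 1 x * t 1 y ^ 2 ∧
    t 3 (x * y) = t 3 x + t 3 y + t 2 x * t 1 y + t 1 x * t 2 y ^ 2 + t 1 x ^ 2 * t 1 y ^ 2 := by
  obtain ⟨u, v, hre, him, h2, h3⟩ := exists_eq x
  obtain ⟨u', v', hre', him', h2', h3'⟩ := exists_eq y
  obtain ⟨r, hr, hr'⟩ := exists_teichmuller_add (t 1 x) (t 1 y)
  have hxy : ((x * y : S20 2) : S2 2).val = ((x : S2 2) : Op 2) * ((y : S2 2) : Op 2) := rfl
  have := t_of_eq (x := x * y) (a := t 1 x + t 1 y)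
    (u := u + u' + 2 * (u * u') +
      ((x : S2 2) : Op 2).im * bar 2 ((y : S2 2) : Op 2).im)
    (v := r + v + v' + u * ((y : S2 2) : Op 2).im + ((x : S2 2) : Op 2).im * bar 2 u')
    (by rw [hxy, Op.mul_re, hre, hre']; push_cast; ring)
    (by
      rw [hxy, Op.mul_im, hre, hre']
      simp only [map_add, map_mul, map_one, map_ofNat]
      linear_combination him + him' + hr)
  rw [this.1, this.2.1, this.2.2, him, him', h2, h3, h2', h3']
  refine ⟨rfl, by simp, ?_⟩
  simp [hr']
  ring

theorem q_mul {x y : S20 2} (hy : y ∈ Sl20 2) : q (x * y) = q x + q y := by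
  obtain ⟨h1, h2, h3⟩ := t_mul x y
  have := t_two_add_sq hy
  rw [q, q, q, h1, h2, h3]
  linear_combination t 1 x * this + Fq_add_self (t 1 x ^ 2 * t 1 y ^ 2) + Fq_add_self (t 2 x * t 1 y)
    + Fq_add_self (t 1 x * t 1 y ^ 3)

/-! ### Explicit elements of norm 1 -/

theorem exists_mem_Sl20 {u b : W 2} (h : (1 + 2 * u) * bar 2 (1 + 2 * u) - 2 * (b * bar 2 b) = 1) :
    ∃ x ∈ Sl20 2, ((x : S2 2) : Op 2).re = 1 + 2 * u ∧ ((x : S2 2) : Op 2).im = b := by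
  -- When the norm is 1, the inverse of a + bS is its conjugate ā − bS.
  let y : S2 2 := ⟨⟨1 + 2 * u, b⟩, ⟨bar 2 (1 + 2 * u), -b⟩,
    by
      ext1
      · simp only [Op.mul_re, Op.one_re, map_neg]; push_cast; linear_combination h
      · simp only [Op.mul_im, Op.one_im, bar_bar]; ring,
    by
      ext1
      · simp only [Op.mul_re, Op.one_re]; push_cast; linear_combination h
      · simp only [Op.mul_im, Op.one_im]; ring⟩
  refine ⟨⟨y, (mem_S20_iff 2 y).mpr ⟨u, by push_cast; ring⟩⟩, ?_, rfl, rfl⟩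
  refine MonoidHom.mem_ker.mpr (Units.ext ?_)
  exact h

theorem exists_t_one_eq_zero (a : Fq 2) : ∃ x ∈ Sl20 2, t 1 x = 0 ∧ q x = a := by
  by_cases ha : a = 0
  · have := t_of_eq (x := 1) (a := 0) (u := 0) (v := 0) (by simp) (by simp)
    exact ⟨1, one_mem _, this.1, by simp [q, this, ha]⟩
  -- The element is −3 − 2[a]S, of norm 9 − 8 = 1.
  obtain ⟨x, hx, hre, him⟩ := exists_mem_Sl20 (u := -2) (b := 2 * -τ a) (by
    have : τ a * τ (a ^ 2) = 1 := by
      rw [← map_mul, show a * a ^ 2 = 1 by linear_combination Fq_pow_three ha, map_one]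
    simp only [map_add, map_mul, map_one, map_ofNat, map_neg, bar_teichmuller]
    linear_combination -8 * this)
  have := t_of_eq (x := x) (a := 0) hre (by rw [him, teichmuller_zero, zero_add])
  exact ⟨x, hx, this.1, by simp [q, this, CharTwo.neg_eq]⟩

theorem exists_t_one_eq (a : Fq 2) : ∃ x ∈ Sl20 2, t 1 x = a := by
  by_cases ha : a = 0
  · obtain ⟨x, hx, h, -⟩ := exists_t_one_eq_zero 0
    exact ⟨x, hx, h.trans ha.symm⟩
  obtain ⟨w, hw⟩ := exists_omega
  have hw0 : w ≠ 0 := by rintro rfl; simp at hw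
  have hw1 : w ≠ 1 := by rintro rfl; simp at hw
  have h3 : τ w ^ 3 = 1 := by rw [← map_pow, Fq_pow_three hw0, map_one]
  have h2 : τ w ^ 2 + τ w + 1 = 0 := by
    have hne : τ w - 1 ≠ 0 := fun h => hw1 <| by
      simpa [sub_eq_zero] using congrArg ρ h
    refine mul_left_cancel₀ hne ?_
    linear_combination h3
  -- With ω = [w] a primitive cube root of unity, 1 + 2ω is a square root of −3 and has norm 3;
  -- adding [a]S lowers the norm by 2.
  obtain ⟨x, hx, hre, him⟩ := exists_mem_Sl20 (u := τ w) (b := τ a) (by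
    have : τ a * τ (a ^ 2) = 1 := by
      rw [← map_mul, show a * a ^ 2 = 1 by linear_combination Fq_pow_three ha, map_one]
    simp only [map_add, map_mul, map_one, map_ofNat, bar_teichmuller, map_pow] at this ⊢
    linear_combination -2 * this + 2 * h2 + 4 * h3)
  exact ⟨x, hx, (t_of_eq hre (v := 0) (by rw [him, mul_zero, add_zero])).1⟩

theorem exists_t_one_eq_and_q_eq (a b : Fq 2) : ∃ x ∈ Sl20 2, t 1 x = a ∧ q x = b := by
  obtain ⟨x, hx, hxa⟩ := exists_t_one_eq a
  obtain ⟨y, hy, hya, hyb⟩ := exists_t_one_eq_zero (b - q x)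
  exact ⟨x * y, mul_mem hx hy, by rw [(t_mul x y).1, hxa, hya, add_zero],
    by rw [q_mul hy, hyb]; ring⟩

/-! ### The `S`-adic filtration -/

/-- The uniformizer `S` of `𝒪₂`. -/
noncomputable def S : Op 2 := ⟨0, 1⟩

/-- Conjugation by `S`. -/
noncomputable def conjS : Op 2 →+* Op 2 where
  toFun x := ⟨bar 2 x.re, bar 2 x.im⟩
  map_one' := by ext1 <;> simp
  map_zero' := by ext1 <;> simp
  map_add' x y := by ext1 <;> simp
  map_mul' x y := by ext1 <;> simp [map_ofNat (bar 2) 2]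

theorem S_mul (y : Op 2) : S * y = conjS y * S := by
  ext1 <;> simp [S, conjS]

theorem natCast_eq (n : ℕ) : (n : Op 2) = ⟨n, 0⟩ := by
  induction n with
  | zero => ext1 <;> simp
  | succ n ih => rw [Nat.cast_succ, ih]; ext1 <;> simp

theorem S_sq : S ^ 2 = 2 := by
  rw [pow_two, show (2 : Op 2) = ((2 : ℕ) : Op 2) by rw [Nat.cast_ofNat], natCast_eq]
  ext1 <;> simp [S]

theorem S_pow_even (m : ℕ) : S ^ (2 * m) = ⟨2 ^ m, 0⟩ := by
  rw [pow_mul, S_sq, show (2 : Op 2) ^ m = ((2 ^ m : ℕ) : Op 2) by push_cast; rfl, natCast_eq]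
  push_cast; rfl

theorem S_pow_mul (n : ℕ) (y : Op 2) : S ^ n * y = conjS^[n] y * S ^ n := by
  induction n generalizing y with
  | zero => simp
  | succ n ih => rw [pow_succ, mul_assoc, S_mul, ← mul_assoc, ih, Function.iterate_succ_apply,
      mul_assoc]

theorem residue_apply (y : Op 2) : Op.residue y = ρ y.re := rfl

@[simp] theorem residue_conjS (y : Op 2) : Op.residue (conjS y) = Op.residue y ^ 2 :=
  residue_bar y.re

theorem exists_mul_S {y : Op 2} (h : Op.residue y = 0) : ∃ z, y = z * S := by
  obtain ⟨d, hd⟩ := exists_two_mul h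
  exact ⟨⟨y.im, d⟩, by ext1 <;> simp [S, hd]⟩

@[simp] theorem residue_S : Op.residue S = 0 := by simp [residue_apply, S]

theorem exists_level_one (x : S20 2) :
    ∃ y, ((x : S2 2) : Op 2) = 1 + y * S ^ 1 ∧ Op.residue y = t 1 x := by
  obtain ⟨u, v, hre, him, -⟩ := exists_eq x
  refine ⟨⟨((x : S2 2) : Op 2).im, u⟩, ?_, ?_⟩
  · ext1 <;> simp [S, hre]
  · simp [residue_apply, him]

theorem exists_level_three {x : S20 2} (h1 : t 1 x = 0) (h2 : t 2 x = 0) :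
    ∃ y, ((x : S2 2) : Op 2) = 1 + y * S ^ 3 ∧ Op.residue y = q x := by
  obtain ⟨u, v, hre, him, hu, hv⟩ := exists_eq x
  obtain ⟨u', rfl⟩ := exists_two_mul (hu.symm.trans h2)
  refine ⟨⟨v, u'⟩, ?_, ?_⟩
  · rw [show S ^ 3 = S ^ (2 * 1) * S from pow_succ S 2, S_pow_even]
    ext1
    · simp [S, hre, map_ofNat (bar 2) 2]; ring_nf; simp
    · simp [S, him, h1]; ring
  · simp [residue_apply, q, h1, hv]

/-- An element of reduced norm `1` has its leading coefficient in `𝔽₂` at even levels. -/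
theorem residue_eq_zero_or_one {x : S20 2} (hx : x ∈ Sl20 2) {m : ℕ} (hm : m ≠ 0) {y : Op 2}
    (h : ((x : S2 2) : Op 2) = 1 + y * S ^ (2 * m)) : Op.residue y = 0 ∨ Op.residue y = 1 := by
  obtain ⟨k, rfl⟩ := Nat.exists_eq_succ_of_ne_zero hm
  have hN := norm_eq_one' hx
  rw [h, S_pow_even] at hN
  simp only [Op.add_re, Op.add_im, Op.mul_re, Op.mul_im, Op.one_re, Op.one_im, map_add, map_mul,
    map_one, map_pow, map_zero, map_ofNat, pow_succ] at hN
  refine Fq_eq_zero_or_one ?_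
  -- The norm equation divided by 2^(k+1); modulo 2 it says that the leading coefficient has trace 0
  -- over 𝔽₂.
  have : y.re + bar 2 y.re + 2 * (2 ^ k * (y.re * bar 2 y.re - 2 * (y.im * bar 2 y.im))) = 0 := by
    refine mul_left_cancel₀ (pow_ne_zero (k + 1) two_ne_zero_W) ?_
    linear_combination hN
  have := congrArg ρ this
  simp only [map_add, map_mul, residue_two, residue_bar, zero_mul, add_zero, map_zero] at this
  exact this

/-! ### Leading coefficients of elements of a subgroup -/

/-- The subgroup `H` contains an element `1 + a S ^ n + ⋯`. -/
def HasLeading (H : Subgroup (Sl20 2)) (n : ℕ) (a : Fq 2) : Prop :=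
  ∃ h ∈ H, ∃ y, (((h : S20 2) : S2 2) : Op 2) = 1 + y * S ^ n ∧ Op.residue y = a

theorem HasLeading.zero (H : Subgroup (Sl20 2)) (n : ℕ) : HasLeading H n 0 :=
  ⟨1, one_mem _, 0, by simp, by simp⟩

/-- In (1 + yS^k)² the term 2yS^k has level k + 2 and (yS^k)² has level at least 2k, so the former
dominates exactly when k ≥ 3. -/
theorem HasLeading.add_two {H : Subgroup (Sl20 2)} {n : ℕ} {a : Fq 2} (h : HasLeading H (n + 3) a) :
    HasLeading H (n + 5) a := by
  obtain ⟨x, hx, y, hy, hya⟩ := h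
  refine ⟨x * x, mul_mem hx hx, y + y * conjS^[n + 3] y * S ^ (n + 1), ?_, ?_⟩
  · have h1 : (((x * x : Sl20 2) : S20 2) : S2 2).val =
        (((x : S20 2) : S2 2) : Op 2) * (((x : S20 2) : S2 2) : Op 2) := rfl
    have h2 : y * S ^ (n + 3) * (y * S ^ (n + 3)) =
        y * conjS^[n + 3] y * S ^ (n + 1) * S ^ (n + 5) := by
      rw [mul_assoc, ← mul_assoc (S ^ _) y, S_pow_mul]
      rw [mul_assoc _ (S ^ (n + 1)), ← pow_add, show n + 1 + (n + 5) = n + 3 + (n + 3) by ring,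
        pow_add S (n + 3)]
      simp only [mul_assoc]
    have h3 : y * S ^ (n + 5) = y * S ^ (n + 3) + y * S ^ (n + 3) := by
      rw [show n + 5 = n + 3 + 2 by ring, pow_add, S_sq, ← mul_assoc, mul_two]
    rw [h1, hy, add_mul y, ← h2, h3]
    noncomm_ring
  · simp [hya]

/-- At level 1 the term (yS)² dominates 2yS, and moving S past y squares the coefficient. -/
theorem HasLeading.sq_one {H : Subgroup (Sl20 2)} {a : Fq 2} (h : HasLeading H 1 a) :
    HasLeading H 2 (a ^ 3) := by
  obtain ⟨x, hx, y, hy, hya⟩ := h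
  refine ⟨x * x, mul_mem hx hx, y * S + y * conjS y, ?_, ?_⟩
  · have h1 : (((x * x : Sl20 2) : S20 2) : S2 2).val =
        (((x : S20 2) : S2 2) : Op 2) * (((x : S20 2) : S2 2) : Op 2) := rfl
    have h2 : y * S * (y * S) = y * conjS y * S ^ 2 := by
      rw [mul_assoc, ← mul_assoc S y, S_mul, pow_two]
      simp only [mul_assoc]
    rw [h1, hy, add_mul (y * S), ← h2, S_sq, pow_one]
    noncomm_ring
  · simp only [map_add, map_mul, residue_S, mul_zero, zero_add, residue_conjS, hya]
    ring

/-- The commutator is 1 + (xx' − x'x)(x'x)⁻¹, and the last factor has residue 1. Moving S³ past y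
gives a⁸ = a². -/
theorem HasLeading.commutator {H : Subgroup (Sl20 2)} {a b : Fq 2} (ha : HasLeading H 1 a)
    (hb : HasLeading H 3 b) : HasLeading H 4 (a * b ^ 2 + b * a ^ 2) := by
  obtain ⟨x, hx, y, hy, rfl⟩ := ha
  obtain ⟨x', hx', y', hy', rfl⟩ := hb
  let r : Sl20 2 := (x' * x)⁻¹
  have hr : Op.residue (((r : S20 2) : S2 2) : Op 2) = 1 :=
    congrArg Units.val (MonoidHom.mem_ker.mp (r : S20 2).2)
  refine ⟨x * x' * r, mul_mem (mul_mem hx hx') (inv_mem (mul_mem hx' hx)),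
    (y * conjS y' - y' * conjS^[3] y) * ((r : S20 2) : S2 2), ?_, ?_⟩
  · have h1 : (((x * x' * r : Sl20 2) : S20 2) : S2 2).val =
        ((x : S20 2) : S2 2).val * ((x' : S20 2) : S2 2).val * ((r : S20 2) : S2 2).val := rfl
    have h0 : ((x' : S20 2) : S2 2).val * ((x : S20 2) : S2 2).val * ((r : S20 2) : S2 2).val = 1 :=
      congrArg (fun z : Sl20 2 => ((z : S20 2) : S2 2).val) (mul_inv_cancel (x' * x))
    have h4 (z : Op 2) : z * S ^ 4 = S ^ 4 * z := by
      rw [show 4 = 2 * 2 by rfl, pow_mul, S_sq]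
      exact (((Nat.commute_cast z 2).pow_right 2).eq)
    have h2 : y * S * (y' * S ^ 3) = y * conjS y' * S ^ 4 := by
      rw [mul_assoc, ← mul_assoc S y', S_mul, pow_succ' S 3]
      simp only [mul_assoc]
    have h3 : y' * S ^ 3 * (y * S) = y' * conjS^[3] y * S ^ 4 := by
      rw [mul_assoc, ← mul_assoc (S ^ 3) y, S_pow_mul, pow_succ S 3]
      simp only [mul_assoc]
    have h5 : ((x : S20 2) : S2 2).val * ((x' : S20 2) : S2 2).val =
        ((x' : S20 2) : S2 2).val * ((x : S20 2) : S2 2).val +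
          (y * conjS y' - y' * conjS^[3] y) * S ^ 4 := by
      rw [hy, hy', sub_mul, ← h2, ← h3, pow_one]
      noncomm_ring
    rw [h1, h5, add_mul, h0, mul_assoc _ (S ^ 4), ← h4, mul_assoc]
  · rw [map_mul, hr]
    simp only [map_sub, map_mul, residue_conjS, Function.iterate_succ, Function.iterate_zero,
      Function.comp, id, CharTwo.sub_eq_add]
    linear_combination Op.residue y' * (Op.residue y ^ 4 + Op.residue y) * Fq_pow_four (Op.residue y)

open Topology

/-! ### All levels of `H`, and successive approximation -/

variable {H : Subgroup (Sl20 2)}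

theorem hasLeading_three
    (hH : ∀ a b : Fq 2, ∃ x ∈ H, t 1 (x : S20 2) = a ∧ q (x : S20 2) = b) (a : Fq 2) :
    HasLeading H 3 a := by
  obtain ⟨x, hx, hx1, hxq⟩ := hH 0 a
  have h2 : t 2 (x : S20 2) + t 2 (x : S20 2) ^ 2 = 0 := by
    rw [t_two_add_sq x.2, hx1]; ring
  rcases Fq_eq_zero_or_one h2 with h2 | h2
  · obtain ⟨y, hy, hya⟩ := exists_level_three hx1 h2
    exact ⟨x, hx, y, hy, hya.trans hxq⟩
  -- Here t₂ = 1 leaves a term at level 2. The square of an element with t₁ = 1 has t₁ = 0, t₂ = 1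
  -- and `q` = 0, so multiplying by it removes this term and keeps `q`.
  · obtain ⟨z, hz, hz1, -⟩ := hH 1 0
    have hzz := t_mul (z : S20 2) z
    have hzq : q ((z : S20 2) * z) = 0 := by rw [q_mul z.2, Fq_add_self]
    rw [hz1, Fq_add_self, Fq_add_self] at hzz
    have hxz := t_mul (x : S20 2) ((z : S20 2) * z)
    have hxzq : q ((x : S20 2) * ((z : S20 2) * z)) = a := by
      rw [q_mul (mul_mem z.2 z.2), hxq, hzq, add_zero]
    rw [hzz.1, hzz.2.1, hx1, h2] at hxz
    obtain ⟨y, hy, hya⟩ := exists_level_three (by simpa using hxz.1)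
      (hxz.2.1.trans (by simpa using Fq_add_self 1))
    exact ⟨x * (z * z), mul_mem hx (mul_mem hz hz), y, hy, hya.trans hxzq⟩

theorem hasLeading_odd
    (hH : ∀ a b : Fq 2, ∃ x ∈ H, t 1 (x : S20 2) = a ∧ q (x : S20 2) = b) (m : ℕ) (a : Fq 2) :
    HasLeading H (2 * m + 1) a := by
  match m with
  | 0 =>
    obtain ⟨x, hx, hx1, -⟩ := hH a 0
    obtain ⟨y, hy, hya⟩ := exists_level_one (x : S20 2)
    exact ⟨x, hx, y, hy, hya.trans hx1⟩
  | m + 1 =>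
    induction m with
    | zero => exact hasLeading_three hH a
    | succ m ih => exact HasLeading.add_two (n := 2 * m) ih

/-- Level 4 needs the commutator: squaring an element of level 2 gives a + a² there, which vanishes
for a in 𝔽₂. -/
theorem hasLeading_even
    (hH : ∀ a b : Fq 2, ∃ x ∈ H, t 1 (x : S20 2) = a ∧ q (x : S20 2) = b) (m : ℕ) :
    HasLeading H (2 * (m + 1)) 1 := by
  match m with
  | 0 => simpa using (hasLeading_odd hH 0 1).sq_one
  | m + 1 =>
    induction m with
    | zero =>
      obtain ⟨w, hw⟩ := exists_omega
      have := (hasLeading_odd hH 0 1).commutator (hasLeading_odd hH 1 w)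
      rwa [one_mul, one_pow, mul_one, hw] at this
    | succ m ih => exact HasLeading.add_two (n := 2 * m + 1) ih

theorem exists_mem_mul_eq
    (hH : ∀ a b : Fq 2, ∃ x ∈ H, t 1 (x : S20 2) = a ∧ q (x : S20 2) = b) (g : Sl20 2) (n : ℕ) :
    ∃ h ∈ H, ∃ y, (((h⁻¹ * g : Sl20 2) : S20 2) : S2 2).val = 1 + y * S ^ (n + 1) := by
  induction n with
  | zero =>
    obtain ⟨y, hy, -⟩ := exists_level_one (g : S20 2)
    exact ⟨1, one_mem _, y, by simpa using hy⟩
  | succ n ih =>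
    obtain ⟨h, hh, y, hy⟩ := ih
    have hD : HasLeading H (n + 1) (Op.residue y) := by
      rcases Nat.even_or_odd' n with ⟨m, rfl | rfl⟩
      · exact hasLeading_odd hH m _
      · rcases residue_eq_zero_or_one (h⁻¹ * g).2 (Nat.succ_ne_zero m) hy with h0 | h0
        · rw [h0]; exact HasLeading.zero _ _
        · rw [h0]; exact hasLeading_even hH m
    obtain ⟨k, hk, z, hz, hzy⟩ := hD
    -- Equal leading coefficients make y − z divisible by S, which gains one level.
    obtain ⟨w, hw⟩ := exists_mul_S (y := (((k⁻¹ : Sl20 2) : S20 2) : S2 2).val * (y - z))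
      (by rw [map_mul, map_sub, hzy, sub_self, mul_zero])
    refine ⟨h * k, mul_mem hh hk, w, ?_⟩
    have h1 : ((((h * k)⁻¹ * g : Sl20 2) : S20 2) : S2 2).val =
        (((k⁻¹ : Sl20 2) : S20 2) : S2 2).val * (((h⁻¹ * g : Sl20 2) : S20 2) : S2 2).val := by
      rw [mul_inv_rev, mul_assoc]; rfl
    have h0 : (((k⁻¹ : Sl20 2) : S20 2) : S2 2).val * ((k : S20 2) : S2 2).val = 1 :=
      congrArg (fun z : Sl20 2 => ((z : S20 2) : S2 2).val) (inv_mul_cancel k)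
    have h2 : (((h⁻¹ * g : Sl20 2) : S20 2) : S2 2).val =
        ((k : S20 2) : S2 2).val + (y - z) * S ^ (n + 1) := by
      rw [hy, hz]; noncomm_ring
    rw [h1, h2, mul_add, h0, ← mul_assoc, hw, mul_assoc, ← pow_succ']

/-! ### The topology -/

theorem hasBasis_nhds_W (a : W 2) :
    (@nhds _ (Ideal.span {((2 : ℕ) : W 2)}).adicTopology a).HasBasis (fun _ : ℕ => True)
      fun n => {b | (2 : W 2) ^ n ∣ b - a} := by
  convert (Ideal.span {((2 : ℕ) : W 2)}).hasBasis_nhds_adic a using 2 with n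
  ext b
  rw [Ideal.span_singleton_pow]
  simp only [Set.mem_ofPred_eq, Set.mem_image, SetLike.mem_coe, Ideal.mem_span_singleton]
  push_cast
  exact ⟨fun h => ⟨b - a, h, by ring⟩, by rintro ⟨c, hc, rfl⟩; simpa using hc⟩

theorem mem_nhds_iff_exists {x : Op 2} {V : Set (Op 2)} :
    V ∈ 𝓝 x ↔ ∃ n : ℕ, ∀ y : Op 2,
      (2 : W 2) ^ n ∣ y.re - x.re → (2 : W 2) ^ n ∣ y.im - x.im → y ∈ V := by
  have key : 𝓝 x = Filter.comap Op.re (@nhds _ (Ideal.span {((2 : ℕ) : W 2)}).adicTopology x.re) ⊓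
      Filter.comap Op.im (@nhds _ (Ideal.span {((2 : ℕ) : W 2)}).adicTopology x.im) := by
    rw [← @nhds_induced _ _ (Ideal.span {((2 : ℕ) : W 2)}).adicTopology,
      ← @nhds_induced _ _ (Ideal.span {((2 : ℕ) : W 2)}).adicTopology]
    exact @nhds_inf _ (.induced Op.re (Ideal.span {((2 : ℕ) : W 2)}).adicTopology)
      (.induced Op.im (Ideal.span {((2 : ℕ) : W 2)}).adicTopology) x
  rw [key, (((hasBasis_nhds_W x.re).comap _).inf ((hasBasis_nhds_W x.im).comap _)).mem_iff]
  constructor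
  · rintro ⟨⟨m, n⟩, -, h⟩
    exact ⟨max m n, fun y h1 h2 => h ⟨(pow_dvd_pow 2 (le_max_left m n)).trans h1,
      (pow_dvd_pow 2 (le_max_right m n)).trans h2⟩⟩
  · rintro ⟨n, h⟩
    exact ⟨⟨n, n⟩, ⟨trivial, trivial⟩, fun y hy => h y hy.1 hy.2⟩

theorem exists_forall_mem_of_mem_nhds {x : Op 2} {V : Set (Op 2)} (hV : V ∈ 𝓝 x) :
    ∃ n : ℕ, ∀ m ≥ n, ∀ z : Op 2, x + (2 : Op 2) ^ m * z ∈ V := by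
  obtain ⟨n, h⟩ := mem_nhds_iff_exists.mp hV
  refine ⟨n, fun m hm z => h _ ?_ ?_⟩ <;>
  rw [← S_sq, ← pow_mul, S_pow_even] <;> simp [Dvd.dvd.mul_right (pow_dvd_pow (2 : W 2) hm)]

theorem dense_of_surjective
    (hH : ∀ a b : Fq 2, ∃ x ∈ H, t 1 (x : S20 2) = a ∧ q (x : S20 2) = b) :
    Dense (H : Set (Sl20 2)) := by
  intro g
  -- In the topology of units, both the approximating element and its inverse must be close to those
  -- of `g`.
  let f : Sl20 2 → Op 2 × (Op 2)ᵐᵒᵖ := fun x => Units.embedProduct (Op 2) ((x : S20 2) : S2 2)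
  have hf : IsInducing f :=
    Units.isInducing_embedProduct.comp (IsInducing.subtypeVal.comp IsInducing.subtypeVal)
  rw [mem_closure_iff_nhds]
  intro U hU
  rw [hf.nhds_eq_comap, Filter.mem_comap] at hU
  obtain ⟨V, hV, hVU⟩ := hU
  obtain ⟨V₁, hV₁, V₂, hV₂, hV⟩ := mem_nhds_prod_iff.mp hV
  have hV₂' : MulOpposite.op ⁻¹' V₂ ∈ 𝓝 (((g⁻¹ : Sl20 2) : S20 2) : S2 2).val :=
    MulOpposite.continuous_op.continuousAt.preimage_mem_nhds hV₂
  obtain ⟨n₁, h₁⟩ := exists_forall_mem_of_mem_nhds hV₁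
  obtain ⟨n₂, h₂⟩ := exists_forall_mem_of_mem_nhds hV₂'
  set m := max n₁ n₂
  obtain ⟨h, hh, y, hy⟩ := exists_mem_mul_eq hH g (2 * m + 1)
  have hcomm (z : Op 2) : z * 2 ^ (m + 1) = 2 ^ (m + 1) * z :=
    ((Nat.commute_cast z 2).pow_right (m + 1)).eq
  rw [show 2 * m + 1 + 1 = 2 * (m + 1) by ring, pow_mul, S_sq] at hy
  have e1 : ((g : S20 2) : S2 2).val = ((h : S20 2) : S2 2).val *
      (((h⁻¹ * g : Sl20 2) : S20 2) : S2 2).val :=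
    congrArg (fun z : Sl20 2 => ((z : S20 2) : S2 2).val) (mul_inv_cancel_left h g).symm
  have e2 : (((h⁻¹ : Sl20 2) : S20 2) : S2 2).val = (((h⁻¹ * g : Sl20 2) : S20 2) : S2 2).val *
      (((g⁻¹ : Sl20 2) : S20 2) : S2 2).val :=
    congrArg (fun z : Sl20 2 => ((z : S20 2) : S2 2).val) (mul_inv_cancel_right h⁻¹ g).symm
  refine ⟨h, hVU (hV ⟨?_, ?_⟩), hh⟩
  · have := h₁ (m + 1) (by omega) (-(((h : S20 2) : S2 2).val * y))
    convert this using 1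
    change ((h : S20 2) : S2 2).val = ((g : S20 2) : S2 2).val + _
    rw [e1, hy, mul_add, mul_one, ← mul_assoc, hcomm, mul_neg]
    noncomm_ring
  · have := h₂ (m + 1) (by omega) (y * (((g⁻¹ : Sl20 2) : S20 2) : S2 2).val)
    have e3 : (((h⁻¹ : Sl20 2) : S20 2) : S2 2).val = (((g⁻¹ : Sl20 2) : S20 2) : S2 2).val +
        2 ^ (m + 1) * (y * (((g⁻¹ : Sl20 2) : S20 2) : S2 2).val) := by
      rw [e2, hy, add_mul, one_mul, hcomm, mul_assoc]
    rw [← e3] at this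
    exact this

theorem surjective_of_dense (hH : Dense (H : Set (Sl20 2))) (a b : Fq 2) :
    ∃ x ∈ H, t 1 (x : S20 2) = a ∧ q (x : S20 2) = b := by
  obtain ⟨g, hg, hg1, hgq⟩ := exists_t_one_eq_and_q_eq a b
  let f : Sl20 2 → Op 2 := fun x => ((x : S20 2) : S2 2)
  have hf : Continuous f :=
    Units.continuous_val.comp (continuous_subtype_val.comp continuous_subtype_val)
  -- Congruence modulo 4 suffices, since t₁, t₂ and t₃ involve only the first two digits.
  let V : Set (Op 2) := {y | (2 : W 2) ^ 2 ∣ y.re - (f ⟨g, hg⟩).re ∧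
    (2 : W 2) ^ 2 ∣ y.im - (f ⟨g, hg⟩).im}
  have hV : V ∈ 𝓝 (f ⟨g, hg⟩) := mem_nhds_iff_exists.mpr ⟨2, fun y h1 h2 => ⟨h1, h2⟩⟩
  obtain ⟨x, hx, hxH⟩ := mem_closure_iff_nhds.mp (hH ⟨g, hg⟩) _
    (hf.continuousAt.preimage_mem_nhds hV)
  have h4 : (2 : W 2) ^ 2 = 4 := by norm_num
  have hre := digit_eq_of_four_dvd (h4 ▸ hx.1)
  have him := digit_eq_of_four_dvd (h4 ▸ hx.2)
  have h1 : t 1 (x : S20 2) = t 1 g := by rw [t_one, t_one]; exact him.1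
  have h2 : t 2 (x : S20 2) = t 2 g := by rw [t_two, t_two]; exact hre.2
  have h3 : t 3 (x : S20 2) = t 3 g := by rw [t_three, t_three]; exact him.2
  exact ⟨x, hxH, h1.trans hg1, by rw [← hgq, q, q, h1, h2, h3]⟩

end MoravaStabilizer

theorem mainTheorem4 (H : Subgroup (MoravaStabilizer.Sl20 2)) :
    Dense (H : Set (MoravaStabilizer.Sl20 2)) ↔
      Function.Surjective (fun x : H =>
        let y : MoravaStabilizer.S20 2 := ((x : MoravaStabilizer.Sl20 2) : MoravaStabilizer.S20 2)
        ((MoravaStabilizer.t 1 y,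
          MoravaStabilizer.t 3 y + MoravaStabilizer.t 1 y * MoravaStabilizer.t 2 y) :
          MoravaStabilizer.Fq 2 × MoravaStabilizer.Fq 2)) := by
  constructor
  · rintro hH ⟨a, b⟩
    obtain ⟨x, hx, h1, h2⟩ := MoravaStabilizer.surjective_of_dense hH a b
    exact ⟨⟨x, hx⟩, Prod.ext h1 h2⟩
  · intro hH
    refine MoravaStabilizer.dense_of_surjective fun a b => ?_
    obtain ⟨⟨x, hx⟩, h⟩ := hH (a, b)
    exact ⟨x, hx, congrArg Prod.fst h, congrArg Prod.snd h⟩
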